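/- Let $p$ be a prime, $n\ge 1$ an integer, $q=p^n$, and let $\mathbb F_q$ be the field with $q$ elements. For a map $f:\mathbb F_q\to\mathbb F_q$ let $P_f$ be the unique polynomial of degree at most $q-1$ over $\mathbb F_q$ that coincides with $f$ on $\mathbb F_q$; let $\deg(f)$ be the degree of $P_f$, and let the weight $\mathrm w(f)$ be the number of nonzero coefficients of $P_f$. The map $f$ has codimension at most $k$ if there are a linearised polynomial $M(X)=\sum_{j=0}^{n-1}a_jX^{p^j}\in\mathbb F_q[X]$ and an $\mathbb F_p$-subspace $U$ of $\mathbb F_q$ of dimension $n-k$ such that $f-M$ is constant on each coset of $U$; the additive index is $\mathrm{AddInd}(f)=p^k$ for the smallest such $k$. If $q\ge 3$ and $f$ is a permutation of $\mathbb F_q$, the Carlitz rank $\mathrm{Crk}(f)$ is the minimum number of inversions in a representation of $f$ as a composition of affine maps $x\mapsto ax+b$ ($a\ne 0$) and of the inversion $x\mapsto x^{q-2}$ (that is, $0\mapsto 0$ and $x\mapsto x^{-1}$ for $x\neq 0$). Theorem. Let $\zeta$ be a primitive element of $\mathbb F_q$ (a generator of $\mathbb F_q^*$) and let $\lambda\in\mathbb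 F_q$ with $\mathbb F_q=\mathbb F_p(\lambda)$. Define $f:\mathbb F_q\to\mathbb F_q$ by $$f(\zeta^x)=x_0+x_1\lambda+\dots+x_{n-1}\lambda^{n-1},\qquad x=0,1,\dots,q-2,$$ where $x=x_0+x_1p+\dots+x_{n-1}p^{n-1}$ with $0\le x_0,\dots,x_{n-1}<p$, and $$f(0)=-1-\lambda-\dots-\lambda^{n-1}.$$ Then $f$ is a permutation of $\mathbb F_q$, and $$\deg(f)\ge q-\frac qp-1,\qquad \mathrm w(f)\ge q-\frac qp,\qquad \mathrm{AddInd}(f)\ge\frac{p^n}{n+2},$$ and, if $p>2$, $$\mathrm{Crk}(f)\ge p^n-3(2p)^{n/2}.$$ -/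

import Mathlib

open Polynomial

/-! ### Complexity measures of self-mappings of a finite field -/

section Polynomials

variable {F : Type*} [Field F] [Fintype F]

open Classical in
/-- The unique polynomial of degree at most `q - 1` (where `q` is the number of elements of `F`)
that coincides with `f` on `F`. -/
noncomputable def representingPoly (f : F → F) : F[X] :=
  Lagrange.interpolate (Finset.univ : Finset F) id f

theorem representingPoly_degree_lt (f : F → F) :
    (representingPoly f).degree < (Fintype.card F : WithBot ℕ) := by
  classical
  have h := Lagrange.degree_interpolate_lt (s := (Finset.univ : Finset F)) (v := id) f
    (Function.injective_id.injOn)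
  rw [Finset.card_univ] at h
  unfold representingPoly
  convert h

theorem representingPoly_eval (f : F → F) (x : F) : (representingPoly f).eval x = f x := by
  classical
  have h := Lagrange.eval_interpolate_at_node (s := (Finset.univ : Finset F)) (v := id) f
    (Function.injective_id.injOn) (Finset.mem_univ x)
  exact h

theorem eq_representingPoly (f : F → F) (P : F[X])
    (hP : P.degree < (Fintype.card F : WithBot ℕ)) (hf : ∀ x, P.eval x = f x) :
    P = representingPoly f := by
  refine Polynomial.eq_of_degrees_lt_of_eval_finset_eq (Finset.univ : Finset F) ?_ ?_ ?_
  · simpa [Finset.card_univ] using hP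
  · simpa [Finset.card_univ] using representingPoly_degree_lt f
  · intro x _
    rw [hf, representingPoly_eval]

/-- The degree of a self-mapping of `F`. -/
noncomputable def mapDegree (f : F → F) : ℕ := (representingPoly f).natDegree

/-- The weight of a self-mapping of `F`: the number of nonzero coefficients of the polynomial
of degree at most `q - 1` representing it. -/
noncomputable def mapWeight (f : F → F) : ℕ := (representingPoly f).support.card

end Polynomials

section CarlitzRank

variable {F : Type*} [Field F]

/-- `IsInversionWord r f`: the map `f` is a composition of affine maps `x ↦ a x + b`, `a ≠ 0`,
and of exactly `r` copies of the inversion `x ↦ x⁻¹` (with `0⁻¹ = 0`; on a finite field with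
`q ≥ 3` elements this is `x ↦ x ^ (q - 2)`). -/
inductive IsInversionWord : ℕ → (F → F) → Prop
  | id : IsInversionWord 0 (fun x => x)
  | affine {r : ℕ} {g : F → F} (a b : F) (ha : a ≠ 0) (hg : IsInversionWord r g) :
      IsInversionWord r (fun x => a * g x + b)
  | inversion {r : ℕ} {g : F → F} (hg : IsInversionWord r g) :
      IsInversionWord (r + 1) (fun x => (g x)⁻¹)

/-- The Carlitz rank of a permutation `f` of a finite field: the minimum number of inversions
needed to write `f` as a composition of the inversion and affine maps. -/
noncomputable def carlitzRank (f : F → F) : ℕ := sInf {r : ℕ | IsInversionWord r f}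

end CarlitzRank

section AdditiveIndex

variable (p : ℕ) [Fact p.Prime] {F : Type*} [Field F] [Algebra (ZMod p) F]

/-- `M` is a linearised polynomial: `M = ∑_{j < n} a_j X ^ (p ^ j)`, where `n = [F : 𝔽_p]`. -/
def IsLinearised (M : F[X]) : Prop :=
  ∃ a : ℕ → F, M = ∑ j ∈ Finset.range (Module.finrank (ZMod p) F), C (a j) * X ^ p ^ j

/-- `f` has codimension at most `k`: there are a linearised polynomial `M` and an `𝔽_p`-subspace
`U` of dimension `n - k` such that `f - M` is constant on each coset of `U`. -/
def HasCodimAtMost (f : F → F) (k : ℕ) : Prop :=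
  ∃ (M : F[X]) (U : Submodule (ZMod p) F), IsLinearised p M ∧
    Module.finrank (ZMod p) U + k = Module.finrank (ZMod p) F ∧
    ∃ a : F ⧸ U → F, ∀ x : F, f x = M.eval x + a (Submodule.Quotient.mk x)

theorem hasCodimAtMost_finrank (f : F → F) :
    HasCodimAtMost p f (Module.finrank (ZMod p) F) := by
  refine ⟨0, ⊥, ⟨fun _ => 0, by simp⟩, by simp, fun v => f (Submodule.quotEquivOfEqBot ⊥ rfl v), ?_⟩
  intro x
  simp

/-- The codimension of `f`: the smallest `k` such that `f` has codimension at most `k`. -/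
noncomputable def mapCodim (f : F → F) : ℕ := sInf {k : ℕ | HasCodimAtMost p f k}

/-- The additive index of `f`. -/
noncomputable def additiveIndex (f : F → F) : ℕ := p ^ mapCodim p f

end AdditiveIndex

section DiscreteLogarithm

variable {F : Type*} [Field F]

/-- `x₀ + x₁ lam + ⋯ + x_{n-1} lam ^ (n-1)`, where `x₀, …, x_{n-1}` are the `n` lowest digits of
`x` in base `p`. -/
def digitCombination (p n : ℕ) (lam : F) (x : ℕ) : F :=
  ∑ i ∈ Finset.range n, ((x / p ^ i % p : ℕ) : F) * lam ^ i

open Classical in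
/-- The map with `f (ζ ^ x) = x₀ + x₁ lam + ⋯ + x_{n-1} lam ^ (n-1)` for `0 ≤ x ≤ p ^ n - 2`
(the exponent of a nonzero `y` is the least `x` with `ζ ^ x = y`) and
`f 0 = -1 - lam - ⋯ - lam ^ (n-1)`. -/
noncomputable def discreteLogMap (p n : ℕ) (ζ : Fˣ) (lam : F) (y : F) : F :=
  if y = 0 then -∑ i ∈ Finset.range n, lam ^ i
  else digitCombination p n lam (sInf {x : ℕ | (ζ : F) ^ x = y})

theorem discreteLogMap_zero (p n : ℕ) (ζ : Fˣ) (lam : F) :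
    discreteLogMap p n ζ lam 0 = -∑ i ∈ Finset.range n, lam ^ i := by
  simp [discreteLogMap]

theorem discreteLogMap_pow [Fintype F] (p n : ℕ) (hF : Fintype.card F = p ^ n) (ζ : Fˣ)
    (hζ : ∀ u : Fˣ, u ∈ Subgroup.zpowers ζ) (lam : F) (x : ℕ) (hx : x < p ^ n - 1) :
    discreteLogMap p n ζ lam ((ζ : F) ^ x) = digitCombination p n lam x := by
  classical
  have hord : orderOf ζ = p ^ n - 1 := by
    rw [orderOf_eq_card_of_forall_mem_zpowers hζ, Nat.card_eq_fintype_card, Fintype.card_units, hF]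
  have hmin : sInf {m : ℕ | (ζ : F) ^ m = (ζ : F) ^ x} = x := by
    have hmem : (ζ : F) ^ sInf {m : ℕ | (ζ : F) ^ m = (ζ : F) ^ x} = (ζ : F) ^ x :=
      Nat.sInf_mem (s := {m : ℕ | (ζ : F) ^ m = (ζ : F) ^ x}) ⟨x, rfl⟩
    have hle : sInf {m : ℕ | (ζ : F) ^ m = (ζ : F) ^ x} ≤ x := Nat.sInf_le rfl
    have hu : ζ ^ sInf {m : ℕ | (ζ : F) ^ m = (ζ : F) ^ x} = ζ ^ x := by
      ext
      simpa using hmem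
    refine pow_injOn_Iio_orderOf ?_ ?_ hu
    · simp only [Set.mem_Iio]
      omega
    · simp only [Set.mem_Iio]
      omega
  have h0 : (ζ : F) ^ x ≠ 0 := pow_ne_zero _ ζ.ne_zero
  simp only [discreteLogMap, if_neg h0, hmin]

end DiscreteLogarithm

/-! ### Base-`p` digits and carries. -/

section DigitCombination

/-! Multiplying the argument by `ζ ^ k` adds `k` to the exponent, so it changes `f` by a constant up
to carries, as long as the exponent does not wrap around. Zero plays the exponent `q - 1`, all of
whose digits are `-1` in `F`; as the powers of `lam` below `n` are independent, `f` is injective.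

Weight and degree: adding `p ^ (n - 1)` touches only the top digit, so `P (ζ ^ m * X) - P - c`, with
`m = p ^ (n - 1)` and `c = lam ^ (n - 1)`, has a long run of consecutive powers of `ζ` as zeros. By
Vandermonde it has many terms, and so has `P` (`lt_card_support_of_eval_pow_add`).

Additive index: `f (ζ y) - f y` takes at most `n + 2` values, but is injective on any subspace `U`
on whose cosets `f` is linear up to constants. Hence `#U ≤ n + 2` (`HasCodimAtMost.card_le`).

Carlitz rank: with `r` inversions, `f` is fractional linear off at most `r` points. For a fixed
shift `k` there are at most `2 ^ (n - 1)` carry patterns, and each fixes the difference of two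
values of `f`, which a fractional linear map attains at most twice. So the set of good exponents has
few pairs with a given difference, and counting all pairs bounds its size. -/

theorem Nat.eq_of_forall_digit_eq {p n x y : ℕ} (hx : x < p ^ n) (hy : y < p ^ n)
    (h : ∀ i < n, x / p ^ i % p = y / p ^ i % p) : x = y := by
  induction n generalizing x y with
  | zero => simp at hx hy; omega
  | succ n ih =>
    have h0 := h 0 n.succ_pos
    simp only [pow_zero, Nat.div_one] at h0
    have hdiv : x / p = y / p := by
      refine ih ?_ ?_ fun i hi => ?_
      · exact Nat.div_lt_of_lt_mul (by rwa [pow_succ'] at hx)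
      · exact Nat.div_lt_of_lt_mul (by rwa [pow_succ'] at hy)
      · have := h (i + 1) (by omega)
        rwa [pow_succ', ← Nat.div_div_eq_div_mul, ← Nat.div_div_eq_div_mul] at this
    rw [← Nat.div_add_mod x p, ← Nat.div_add_mod y p, hdiv, h0]

variable {F : Type*} [Field F]

/-- Reduction mod `p` is invisible in characteristic `p`, so floor quotients can replace digits and
carries are read off from floors of sums. -/
theorem digitCombination_eq_sum (p n : ℕ) [CharP F p] (lam : F) (x : ℕ) :
    digitCombination p n lam x = ∑ i ∈ Finset.range n, ((x / p ^ i : ℕ) : F) * lam ^ i := by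
  unfold digitCombination
  refine Finset.sum_congr rfl fun i _ => ?_
  rw [← CharP.cast_eq_mod F p]

variable {p : ℕ} [Fact p.Prime] {n : ℕ}

theorem digitCombination_sub_one [CharP F p] (lam : F) :
    digitCombination p n lam (p ^ n - 1) = -∑ i ∈ Finset.range n, lam ^ i := by
  have hp : 0 < p := (Fact.out : p.Prime).pos
  rw [digitCombination_eq_sum, ← Finset.sum_neg_distrib]
  refine Finset.sum_congr rfl fun i hi => ?_
  have hi : i < n := Finset.mem_range.mp hi
  obtain ⟨k, rfl⟩ := Nat.exists_eq_add_of_lt hi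
  have hdiv : (p ^ (i + k + 1) - 1) / p ^ i = p ^ (k + 1) - 1 := by
    have hpi : 0 < p ^ i := pow_pos hp i
    have hpk : 0 < p ^ (k + 1) := pow_pos hp _
    rw [add_assoc, pow_add]
    refine Nat.div_eq_of_lt_le ?_ ?_
    · rw [Nat.sub_mul, one_mul, mul_comm]
      omega
    · rw [Nat.sub_add_cancel hpk, mul_comm]
      exact Nat.sub_lt (Nat.mul_pos hpk hpi) one_pos
  rw [hdiv, Nat.cast_sub (Nat.one_le_pow _ _ hp)]
  simp

/-- Adding `k` to `x` changes `digitCombination` by that of `k` and a sum of carries, which are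
`0` or `1` and absent in the lowest position. -/
theorem exists_carries [CharP F p] (lam : F) (x k : ℕ) :
    ∃ c : Fin n → Bool,
      digitCombination p (n + 1) lam (x + k) - digitCombination p (n + 1) lam x =
        digitCombination p (n + 1) lam k +
          ∑ i : Fin n, if c i then lam ^ ((i : ℕ) + 1) else 0 := by
  have hp : 0 < p := (Fact.out : p.Prime).pos
  -- The carry out of the lowest `i + 1` digits, in the form in which `Nat.add_div` produces it.
  refine ⟨fun i => decide (p ^ ((i : ℕ) + 1) ≤
    x % p ^ ((i : ℕ) + 1) + k % p ^ ((i : ℕ) + 1)), ?_⟩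
  simp only [digitCombination_eq_sum, Finset.sum_range_succ']
  rw [add_sub_add_comm, ← Finset.sum_sub_distrib, add_comm, add_right_comm,
    add_comm _ (((k / p ^ 0 : ℕ) : F) * lam ^ 0)]
  congr 1
  · simp only [pow_zero, Nat.div_one]; push_cast; ring
  · rw [Finset.sum_range, Finset.sum_range, ← Finset.sum_add_distrib]
    refine Finset.sum_congr rfl fun i _ => ?_
    rw [Nat.add_div (pow_pos hp _)]
    by_cases h : p ^ ((i : ℕ) + 1) ≤ x % p ^ ((i : ℕ) + 1) + k % p ^ ((i : ℕ) + 1)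
    · simp only [h, if_true, decide_true]; push_cast; ring
    · simp only [h, if_false, decide_false]; push_cast; simp; ring

/-- Adding `1` to `x` changes `digitCombination` by `1 + lam + ⋯ + lam ^ j` for some `j < n`. -/
theorem exists_digitCombination_succ [CharP F p] (lam : F) {x : ℕ} (hx : x + 1 < p ^ n) :
    ∃ j < n, digitCombination p n lam (x + 1) - digitCombination p n lam x =
        ∑ i ∈ Finset.range (j + 1), lam ^ i := by
  have hp : p.Prime := Fact.out
  have hx0 : x + 1 ≠ 0 := by omega
  -- The floor of `x / p ^ i` grows by one exactly when `p ^ i` divides `x + 1`, that is, for `i ≤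
  -- j`.
  set j := padicValNat p (x + 1) with hj
  have hjn : j < n := by
    have := Nat.le_of_dvd (by omega) (pow_padicValNat_dvd (p := p) (n := x + 1))
    exact (Nat.pow_lt_pow_iff_right hp.one_lt).mp (this.trans_lt hx)
  refine ⟨j, hjn, ?_⟩
  simp only [digitCombination_eq_sum, ← Finset.sum_sub_distrib]
  rw [← Finset.sum_subset (Finset.range_subset_range.mpr hjn)]
  · refine Finset.sum_congr rfl fun i hi => ?_
    have hd : p ^ i ∣ x + 1 := (padicValNat_dvd_iff_le hx0).mpr
      (by have := Finset.mem_range.mp hi; omega)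
    rw [Nat.succ_div_of_dvd hd]
    push_cast; ring
  · intro i _ hi
    have hd : ¬ p ^ i ∣ x + 1 := fun h => by
      have := (padicValNat_dvd_iff_le hx0).mp h
      rw [Finset.mem_range] at hi
      omega
    rw [Nat.succ_div_of_not_dvd hd]
    ring

theorem digitCombination_add_pow [CharP F p] (lam : F) (hn : 0 < n) (x : ℕ) :
    digitCombination p n lam (x + p ^ (n - 1)) =
      digitCombination p n lam x + lam ^ (n - 1) := by
  have hp : p.Prime := Fact.out
  obtain ⟨m, rfl⟩ : ∃ m, n = m + 1 := ⟨n - 1, by omega⟩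
  simp only [digitCombination_eq_sum, Finset.sum_range_succ, Nat.add_sub_cancel]
  rw [Nat.add_div_right _ (pow_pos hp.pos m), add_assoc]
  congr 1
  · refine Finset.sum_congr rfl fun i hi => ?_
    obtain ⟨k, rfl⟩ := Nat.exists_eq_add_of_lt (Finset.mem_range.mp hi)
    rw [add_assoc, pow_add, Nat.add_mul_div_left _ _ (pow_pos hp.pos i)]
    simp
  · push_cast; ring

variable [Fintype F] [Algebra (ZMod p) F]

theorem finrank_eq_of_card_eq (hF : Fintype.card F = p ^ n) :
    Module.finrank (ZMod p) F = n := by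
  have h := Module.card_eq_pow_finrank (K := ZMod p) (V := F)
  rw [hF, ZMod.card] at h
  exact (Nat.pow_right_injective (Fact.out : p.Prime).two_le h).symm

theorem linearIndependent_pow_of_adjoin_eq_top (hF : Fintype.card F = p ^ n) {lam : F}
    (hlam : IntermediateField.adjoin (ZMod p) {lam} = ⊤) :
    LinearIndependent (ZMod p) fun i : Fin n => lam ^ (i : ℕ) := by
  have hint : IsIntegral (ZMod p) lam := Algebra.IsIntegral.isIntegral lam
  have hdeg : (minpoly (ZMod p) lam).natDegree = n := by
    rw [← IntermediateField.adjoin.finrank hint, hlam, IntermediateField.finrank_top',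
      finrank_eq_of_card_eq hF]
  subst hdeg
  exact linearIndependent_pow lam

theorem digitCombination_injOn (hF : Fintype.card F = p ^ n) {lam : F}
    (hlam : IntermediateField.adjoin (ZMod p) {lam} = ⊤) :
    Set.InjOn (digitCombination p n lam) (Set.Iio (p ^ n)) := by
  intro x hx y hy h
  have : CharP F p := charP_of_injective_algebraMap' (ZMod p) p
  rw [digitCombination_eq_sum, digitCombination_eq_sum, Finset.sum_range, Finset.sum_range] at h
  have hli := linearIndependent_pow_of_adjoin_eq_top hF hlam
  have hcoe : ∀ z : ℕ, ∑ i : Fin n, ((z / p ^ (i : ℕ) : ℕ) : F) * lam ^ (i : ℕ) =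
      ∑ i : Fin n, ((z / p ^ (i : ℕ) : ℕ) : ZMod p) • lam ^ (i : ℕ) := by
    intro z
    simp [Algebra.smul_def]
  rw [hcoe, hcoe] at h
  have hcoeff := Fintype.linearIndependent_iffₛ.mp hli _ _ h
  refine Nat.eq_of_forall_digit_eq hx hy fun i hi => ?_
  exact (ZMod.natCast_eq_natCast_iff' _ _ _).mp (hcoeff ⟨i, hi⟩)

end DigitCombination

/-! ### Sparse polynomials and Vandermonde. -/

section Weight

variable {F : Type*} [Field F]

/-- A nonzero polynomial that vanishes at `1, ζ, …, ζ ^ (L - 1)` has more than `L` nonzero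
coefficients, if the powers of `ζ` with exponents in its support are distinct. -/
theorem lt_card_support_of_forall_eval_pow_eq_zero {ζ : F} {h : F[X]} (h0 : h ≠ 0)
    (hinj : Set.InjOn (fun i : ℕ => ζ ^ i) h.support) {L : ℕ}
    (hz : ∀ x < L, h.eval (ζ ^ x) = 0) : L < h.support.card := by
  by_contra! hle
  let e := h.support.equivFin
  have hv : (fun j => h.coeff (e.symm j : ℕ)) = 0 := by
    refine Matrix.eq_zero_of_forall_pow_sum_mul_pow_eq_zero
      (f := fun j => ζ ^ (e.symm j : ℕ)) ?_ ?_
    · intro i j hij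
      exact e.symm.injective (Subtype.ext (hinj (e.symm i).2 (e.symm j).2 hij))
    · intro i
      rw [e.symm.sum_comp fun k : h.support => h.coeff (k : ℕ) * (ζ ^ (k : ℕ)) ^ (i : ℕ),
        Finset.sum_coe_sort h.support fun k => h.coeff k * (ζ ^ k) ^ (i : ℕ)]
      rw [← hz i (i.2.trans_le hle), eval_eq_sum, sum_def]
      exact Finset.sum_congr rfl fun k _ => by rw [← pow_mul, ← pow_mul, mul_comm k]
  obtain ⟨k, hk⟩ := Polynomial.support_nonempty.mpr h0
  have := congrFun hv (e ⟨k, hk⟩)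
  simp only [Equiv.symm_apply_apply, Pi.zero_apply] at this
  exact (mem_support_iff.mp hk) this

/-- If `P` has degree less than `q`, `P 0 ≠ 0`, and `P (ζ ^ (x + m)) - P (ζ ^ x)` is a nonzero
constant for `L` consecutive values of `x`, then `P` has more than `L` nonzero coefficients. -/
theorem lt_card_support_of_eval_pow_add {ζ : F} {P : F[X]} {N : ℕ} (hN : 0 < N)
    (hord : orderOf ζ = N) (hdeg : P.natDegree ≤ N) (hP0 : P.eval 0 ≠ 0) {m L : ℕ} {c : F}
    (hc : c ≠ 0) (hP : ∀ x < L, P.eval (ζ ^ (x + m)) = P.eval (ζ ^ x) + c) :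
    L < P.support.card := by
  -- The constant term of `h` is `-c`, so `h ≠ 0`; other terms of `h` come from terms of `P`, and `P
  -- 0 ≠ 0` covers exponent `0`.
  set h : F[X] := P.comp (C (ζ ^ m) * X) - P - C c with hh
  have hcoeff : ∀ i, h.coeff i = P.coeff i * ((ζ ^ m) ^ i - 1) - if i = 0 then c else 0 := by
    intro i
    rw [hh, coeff_sub, coeff_sub, comp_C_mul_X_coeff, coeff_C]
    ring
  have hne : h ≠ 0 := by
    intro h0
    have := hcoeff 0
    rw [h0] at this
    simp at this
    exact hc this
  have hsub : h.support ⊆ P.support := by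
    intro i hi
    rw [mem_support_iff] at hi ⊢
    rcases eq_or_ne i 0 with rfl | hi0
    · rwa [coeff_zero_eq_eval_zero]
    · intro hPi
      exact hi (by rw [hcoeff, hPi]; simp [hi0])
  -- Exponents `0` and `N` would give the same power of `ζ`; the term of degree `N` cancels because
  -- `ζ ^ N = 1`.
  have hlt : ∀ i ∈ h.support, i < N := by
    intro i hi
    refine lt_of_le_of_ne ((le_natDegree_of_mem_supp i (hsub hi)).trans hdeg) ?_
    rintro rfl
    rw [mem_support_iff, hcoeff, pow_right_comm, ← hord, pow_orderOf_eq_one] at hi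
    simp [hord, hN.ne'] at hi
  refine (lt_card_support_of_forall_eval_pow_eq_zero (ζ := ζ) hne ?_ ?_).trans_le
    (Finset.card_le_card hsub)
  · intro i hi j hj hij
    exact pow_injOn_Iio_orderOf (by rw [hord]; exact hlt i hi) (by rw [hord]; exact hlt j hj) hij
  · intro x hx
    have := hP x hx
    rw [pow_add, mul_comm] at this
    simp [hh, this]

end Weight

/-! ### Maps linear on cosets. -/

section AdditiveIndex

variable {p : ℕ} [Fact p.Prime] {F : Type*} [Field F] [Algebra (ZMod p) F]

theorem IsLinearised.eval_add {M : F[X]} (hM : IsLinearised p M) (x y : F) :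
    M.eval (x + y) = M.eval x + M.eval y := by
  have : CharP F p := charP_of_injective_algebraMap' (ZMod p) p
  obtain ⟨a, rfl⟩ := hM
  simp only [eval_finsetSum, eval_mul, eval_C, eval_pow, eval_X, ← Finset.sum_add_distrib]
  exact Finset.sum_congr rfl fun j _ => by rw [add_pow_char_pow, mul_add]

/-- If `f` is injective and `f (ζ y) - f y` takes at most `#E` values, then a subspace on whose
cosets `f` is linear up to constants has at most `#E` elements. -/
theorem HasCodimAtMost.card_le [Fintype F] {f : F → F} (hf : Function.Injective f) {ζ : F}
    (hζ : ζ ≠ 1) {E : Finset F} (hE : ∀ y, f (ζ * y) - f y ∈ E) {k : ℕ}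
    (hk : HasCodimAtMost p f k) : Fintype.card F ≤ E.card * p ^ k := by
  classical
  obtain ⟨M, U, hM, hU, a, ha⟩ := hk
  have hshift : ∀ x, ∀ u ∈ U, f (x + u) = f x + M.eval u := by
    intro x u hu
    have hq : (Submodule.Quotient.mk (x + u) : F ⧸ U) = Submodule.Quotient.mk x := by
      rw [Submodule.Quotient.eq]; simpa using hu
    rw [ha (x + u), ha x, hM.eval_add, hq]
    ring
  have hinj : Function.Injective fun u : U => (⟨_, hE u⟩ : E) := by
    intro u v huv
    have huv : f (ζ * u) - f u = f (ζ * v) - f v := congrArg Subtype.val huv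
    have hw := (u - v).2
    have h1 := hshift v _ hw
    have h2 := hshift (ζ * v) _ hw
    rw [show (v : F) + ((u - v : U) : F) = u by push_cast; ring] at h1
    -- Both sides have the same image: moving by `u - v` adds `M (u - v) = f u - f v = f (ζ u) - f
    -- (ζ v)`.
    have h3 : ζ * v + ((u - v : U) : F) = ζ * u := hf (by rw [h2]; linear_combination -h1 - huv)
    push_cast at h3
    have h4 : (ζ - 1) * ((u : F) - v) = 0 := by linear_combination -h3
    rcases mul_eq_zero.mp h4 with h | h
    · exact absurd (sub_eq_zero.mp h) hζ
    · exact Subtype.ext (sub_eq_zero.mp h)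
  have hcard := Fintype.card_le_of_injective _ hinj
  rw [Module.card_eq_pow_finrank (K := ZMod p) (V := U), ZMod.card, Fintype.card_coe] at hcard
  rw [Module.card_eq_pow_finrank (K := ZMod p) (V := F), ZMod.card, ← hU, pow_add]
  exact Nat.mul_le_mul_right _ hcard

theorem hasCodimAtMost_mapCodim (f : F → F) : HasCodimAtMost p f (mapCodim p f) :=
  Nat.sInf_mem (s := {k : ℕ | HasCodimAtMost p f k}) ⟨_, hasCodimAtMost_finrank p f⟩

end AdditiveIndex

/-! ### Inversion words and fractional linear maps. -/

section CarlitzRank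

variable {F : Type*} [Field F]

theorem IsInversionWord.comp {r s : ℕ} {f g : F → F} (hf : IsInversionWord r f)
    (hg : IsInversionWord s g) : IsInversionWord (r + s) (fun x => f (g x)) := by
  induction hf with
  | id => simpa using hg
  | affine a b ha _ ih => exact ih.affine a b ha
  | inversion _ ih =>
    rw [add_right_comm]
    exact ih.inversion

/-- As a fractional linear map the word is the identity; only the convention `0⁻¹ = 0` makes it
exchange `0` and `a`. -/
theorem isInversionWord_swap_zero [DecidableEq F] {a : F} (ha : a ≠ 0) :
    IsInversionWord 3 (Equiv.swap 0 a : F → F) := by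
  have h := ((((((IsInversionWord.id (F := F)).affine 1 (-a) one_ne_zero).inversion).affine 1 a⁻¹
    one_ne_zero).inversion.affine 1 (-a) one_ne_zero).inversion).affine (-a ^ 2) 0
    (neg_ne_zero.mpr (pow_ne_zero 2 ha))
  convert h using 1
  ext x
  rcases eq_or_ne x 0 with rfl | hx
  · simp [Equiv.swap_apply_left]
    field_simp
  rcases eq_or_ne x a with rfl | hxa
  · simp
  have hxa' : x - a ≠ 0 := sub_ne_zero.mpr hxa
  rw [Equiv.swap_apply_of_ne_of_ne hx hxa]
  have h1 : 1 * (1 * x + -a)⁻¹ + a⁻¹ = x / (a * (x - a)) := by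
    rw [one_mul, one_mul, ← sub_eq_add_neg]
    field_simp
    ring
  have h2 : 1 * (x / (a * (x - a)))⁻¹ + -a = -(a ^ 2 / x) := by
    field_simp
    ring
  rw [h1, h2]
  field_simp
  ring

/-- Every permutation of a finite field is a composition of affine maps and inversions. -/
theorem exists_isInversionWord [Finite F] (σ : Equiv.Perm F) :
    ∃ r, IsInversionWord r (σ : F → F) := by
  classical
  induction σ using Equiv.Perm.swap_induction_on with
  | one => exact ⟨0, IsInversionWord.id⟩
  | swap_mul σ x y hxy ih =>
    obtain ⟨r, hr⟩ := ih
    have h := ((isInversionWord_swap_zero (sub_ne_zero.mpr hxy.symm)).comp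
      ((IsInversionWord.id (F := F)).affine 1 (-x) one_ne_zero)).affine 1 x one_ne_zero
    refine ⟨3 + 0 + r, IsInversionWord.comp (f := Equiv.swap x y) ?_ hr⟩
    convert h using 1
    ext z
    simp only [Equiv.swap_apply_def, one_mul, ← sub_eq_add_neg, sub_eq_zero, sub_left_inj]
    split_ifs <;> simp

/-- A composition of affine maps and `r` inversions is a fractional linear transformation away
from at most `r` points. -/
theorem IsInversionWord.exists_fractionalLinear {r : ℕ} {f : F → F} (hf : IsInversionWord r f) :
    ∃ (a b c d : F) (O : Finset F), a * d - b * c ≠ 0 ∧ O.card ≤ r ∧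
      ∀ x ∉ O, c * x + d ≠ 0 ∧ f x = (a * x + b) / (c * x + d) := by
  classical
  induction hf with
  | id => exact ⟨1, 0, 0, 1, ∅, by simp, by simp, by simp⟩
  | affine s t hs _ ih =>
    obtain ⟨a, b, c, d, O, hdet, hO, h⟩ := ih
    refine ⟨s * a + t * c, s * b + t * d, c, d, O, ?_, hO, fun x hx => ⟨(h x hx).1, ?_⟩⟩
    · convert mul_ne_zero hs hdet using 1
      ring
    · beta_reduce
      rw [(h x hx).2]
      rw [mul_div_assoc', div_add' _ _ _ (h x hx).1]
      ring
  | inversion _ ih =>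
    obtain ⟨a, b, c, d, O, hdet, hO, h⟩ := ih
    -- The new exception is the zero of the numerator. If `a = 0`, the numerator is a nonzero
    -- constant and the extra point is harmless.
    refine ⟨c, d, a, b, insert (-b / a) O, ?_, ?_, fun x hx => ⟨?_, ?_⟩⟩
    · contrapose! hdet
      linear_combination -hdet
    · exact (Finset.card_insert_le _ _).trans (Nat.succ_le_succ hO)
    · rw [Finset.mem_insert, not_or] at hx
      rcases eq_or_ne a 0 with rfl | ha
      · contrapose! hdet
        linear_combination -c * hdet
      · contrapose! hx
        intro h
        exact absurd (by field_simp; linear_combination hx) h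
    · beta_reduce
      rw [(h x fun hO => hx (Finset.mem_insert_of_mem hO)).2, inv_div]

end CarlitzRank

/-! ### Counting solutions and pairs. -/

section Counting

variable {F : Type*} [Field F]

/-- A fractional linear transformation `ψ` satisfies `ψ (z y) - ψ y = D` for at most two `y`, if
`z ≠ 0, 1`. -/
theorem card_le_two_of_fractionalLinear_sub_eq {a b c d z D : F} (hdet : a * d - b * c ≠ 0)
    (hz0 : z ≠ 0) (hz1 : z ≠ 1) {S : Finset F}
    (hS : ∀ y ∈ S, c * y + d ≠ 0 ∧ c * (z * y) + d ≠ 0 ∧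
      (a * (z * y) + b) / (c * (z * y) + d) - (a * y + b) / (c * y + d) = D) :
    S.card ≤ 2 := by
  classical
  have hz1' : z - 1 ≠ 0 := sub_ne_zero.mpr hz1
  -- The equation `ψ (z y) - ψ y = D` with denominators cleared.
  set Q : F[X] := C (D * c ^ 2 * z) * X ^ 2 +
    C (D * c * d * (z + 1) - (a * d - b * c) * (z - 1)) * X + C (D * d ^ 2) with hQ
  have hQ0 : Q ≠ 0 := by
    intro h0
    have hcoeff : ∀ u v w : F, C u * X ^ 2 + C v * X + C w = 0 → u = 0 ∧ v = 0 ∧ w = 0 := by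
      intro u v w h
      refine ⟨?_, ?_, ?_⟩
      · simpa [coeff_X, coeff_C] using congrArg (coeff · 2) h
      · simpa [coeff_X, coeff_C] using congrArg (coeff · 1) h
      · simpa [coeff_X, coeff_C] using congrArg (coeff · 0) h
    obtain ⟨h2, h1, h00⟩ := hcoeff _ _ _ h0
    rcases eq_or_ne D 0 with rfl | hD
    · simp [hdet, hz1'] at h1
    · have hc : c = 0 := by simpa [hD, hz0] using h2
      have hd : d = 0 := by simpa [hD] using h00
      exact hdet (by rw [hc, hd]; ring)
  have hsub : S ⊆ Q.roots.toFinset := by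
    intro y hy
    obtain ⟨h1, h2, h3⟩ := hS y hy
    rw [Multiset.mem_toFinset, mem_roots hQ0, IsRoot.def, hQ]
    simp only [eval_add, eval_mul, eval_C, eval_pow, eval_X]
    rw [div_sub_div _ _ h2 h1, div_eq_iff (mul_ne_zero h2 h1)] at h3
    linear_combination -h3
  calc S.card ≤ Q.roots.toFinset.card := Finset.card_le_card hsub
    _ ≤ Q.roots.card := Multiset.toFinset_card_le _
    _ ≤ Q.natDegree := card_roots' Q
    _ ≤ 2 := natDegree_quadratic_le

/-- Pairs `x < y` in `T` are sorted by their difference, which takes at most `N - 1` values; the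
factor `2` accounts for order. -/
theorem Finset.card_mul_card_sub_one_le {T : Finset ℕ} {N B : ℕ} (hT : ∀ x ∈ T, x < N)
    (hB : ∀ k, 0 < k → k < N → (T.filter fun x => x + k ∈ T).card ≤ B) :
    T.card * (T.card - 1) ≤ 2 * (B * (N - 1)) := by
  classical
  set P := T.offDiag.filter fun z => z.1 < z.2 with hP
  have hPcard : P.card ≤ B * (N - 1) := by
    have hIoo : (Finset.Ioo 0 N).card = N - 1 := by simp
    rw [← hIoo]
    refine Finset.card_le_mul_card_image_of_maps_to (f := fun z : ℕ × ℕ => z.2 - z.1) ?_ B ?_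
    · rintro ⟨x, y⟩ hz
      simp only [hP, Finset.mem_filter, Finset.mem_offDiag] at hz
      have := hT y hz.1.2.1
      simp only [Finset.mem_Ioo]
      omega
    · intro k hk
      rw [Finset.mem_Ioo] at hk
      refine (Finset.card_le_card_of_injOn Prod.fst ?_ ?_).trans (hB k hk.1 hk.2)
      · rintro ⟨x, y⟩ hz
        simp only [hP, Finset.coe_filter, Finset.mem_filter, Finset.mem_offDiag,
          Set.mem_ofPred_eq] at hz ⊢
        obtain ⟨⟨⟨hx, hy, _⟩, hlt⟩, hk⟩ := hz
        exact ⟨hx, by rwa [← hk, Nat.add_sub_cancel' hlt.le]⟩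
      · rintro ⟨x, y⟩ hz ⟨x', y'⟩ hz' h
        simp only [hP, Finset.coe_filter, Finset.mem_filter, Finset.mem_offDiag,
          Set.mem_ofPred_eq] at hz hz' h
        ext <;> simp only <;> omega
  have hswap : (T.offDiag.filter fun z => ¬ z.1 < z.2).card ≤ P.card := by
    refine Finset.card_le_card_of_injOn Prod.swap ?_ Prod.swap_injective.injOn
    rintro ⟨x, y⟩ hz
    simp only [hP, Finset.coe_filter, Finset.mem_offDiag,
      Set.mem_ofPred_eq, Prod.swap] at hz ⊢
    exact ⟨⟨hz.1.2.1, hz.1.1, hz.1.2.2.symm⟩, by omega⟩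
  have hsum : P.card + (T.offDiag.filter fun z => ¬ z.1 < z.2).card = T.offDiag.card :=
    Finset.card_filter_add_card_filter_not _
  have hoff := Finset.offDiag_card T
  rw [← Nat.mul_sub_one] at hoff
  omega

end Counting

/-! ### Application to the discrete logarithm map. -/

section DiscreteLogMap

variable {p : ℕ} [Fact p.Prime] {F : Type*} [Field F] [Fintype F]

theorem orderOf_eq_card_sub_one {ζ : Fˣ} (hζ : ∀ u : Fˣ, u ∈ Subgroup.zpowers ζ) :
    orderOf (ζ : F) = Fintype.card F - 1 := by
  classical
  rw [orderOf_units, orderOf_eq_card_of_forall_mem_zpowers hζ, Nat.card_eq_fintype_card,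
    Fintype.card_units]

theorem exists_pow_eq_of_ne_zero {ζ : Fˣ} (hζ : ∀ u : Fˣ, u ∈ Subgroup.zpowers ζ) {y : F}
    (hy : y ≠ 0) : ∃ x < Fintype.card F - 1, (ζ : F) ^ x = y := by
  classical
  have hfin : IsOfFinOrder ζ := isOfFinOrder_of_finite ζ
  have hmem := hfin.mem_powers_iff_mem_zpowers.mpr (hζ (Units.mk0 y hy))
  rw [hfin.mem_powers_iff_mem_range_orderOf, Finset.mem_image] at hmem
  obtain ⟨x, hx, hxy⟩ := hmem
  refine ⟨x, ?_, by rw [← Units.val_pow_eq_pow_val, hxy, Units.val_mk0]⟩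
  rw [← orderOf_eq_card_sub_one hζ, orderOf_units]
  exact Finset.mem_range.mp hx

theorem pow_pos_lt_ne_one {ζ : Fˣ} (hζ : ∀ u : Fˣ, u ∈ Subgroup.zpowers ζ) {k : ℕ}
    (hk0 : 0 < k) (hk : k < Fintype.card F - 1) : (ζ : F) ^ k ≠ 1 := by
  rw [← orderOf_eq_card_sub_one hζ] at hk
  exact pow_ne_one_of_lt_orderOf hk0.ne' hk

variable [Algebra (ZMod p) F] {n : ℕ}

theorem discreteLogMap_injective (hF : Fintype.card F = p ^ n) {ζ : Fˣ}
    (hζ : ∀ u : Fˣ, u ∈ Subgroup.zpowers ζ) {lam : F}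
    (hlam : IntermediateField.adjoin (ZMod p) {lam} = ⊤) :
    Function.Injective (discreteLogMap p n ζ lam) := by
  have : CharP F p := charP_of_injective_algebraMap' (ZMod p) p
  have hq : 0 < p ^ n := hF ▸ Fintype.card_pos
  have hrep : ∀ y : F, ∃ x < p ^ n, discreteLogMap p n ζ lam y = digitCombination p n lam x ∧
      y = if x = p ^ n - 1 then 0 else (ζ : F) ^ x := by
    intro y
    rcases eq_or_ne y 0 with rfl | hy
    · exact ⟨p ^ n - 1, by omega, by rw [discreteLogMap_zero, digitCombination_sub_one], by simp⟩
    · obtain ⟨x, hx, rfl⟩ := exists_pow_eq_of_ne_zero hζ hy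
      rw [hF] at hx
      exact ⟨x, by omega, discreteLogMap_pow p n hF ζ hζ lam x hx, by rw [if_neg hx.ne]⟩
  intro y y' h
  obtain ⟨x, hx, hfx, hy⟩ := hrep y
  obtain ⟨x', hx', hfx', hy'⟩ := hrep y'
  rw [hfx, hfx'] at h
  rw [hy, hy', digitCombination_injOn hF hlam hx hx' h]

theorem le_mapWeight_discreteLogMap (hn : 0 < n) (hF : Fintype.card F = p ^ n) {ζ : Fˣ}
    (hζ : ∀ u : Fˣ, u ∈ Subgroup.zpowers ζ) {lam : F}
    (hlam : IntermediateField.adjoin (ZMod p) {lam} = ⊤) :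
    p ^ n ≤ mapWeight (discreteLogMap p n ζ lam) + p ^ (n - 1) := by
  have : CharP F p := charP_of_injective_algebraMap' (ZMod p) p
  have hp : p.Prime := Fact.out
  have hq : 1 < p ^ n := hF ▸ Fintype.one_lt_card
  have hpn : p ^ (n - 1) < p ^ n := Nat.pow_lt_pow_right hp.one_lt (by omega)
  have hinj := digitCombination_injOn hF hlam
  have hzero : digitCombination p n lam 0 = 0 := by simp [digitCombination]
  have hdeg : (representingPoly (discreteLogMap p n ζ lam)).natDegree ≤ p ^ n - 1 := by
    refine Nat.le_sub_one_of_lt ?_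
    rcases eq_or_ne (representingPoly (discreteLogMap p n ζ lam)) 0 with h | h
    · rw [h, natDegree_zero]; omega
    · rw [← hF]
      exact (natDegree_lt_iff_degree_lt h).mpr (representingPoly_degree_lt _)
  have hP0 : (representingPoly (discreteLogMap p n ζ lam)).eval 0 ≠ 0 := by
    rw [representingPoly_eval, discreteLogMap_zero, ← digitCombination_sub_one (p := p), ← hzero]
    intro h
    have := hinj (Set.mem_Iio.mpr (by omega)) (Set.mem_Iio.mpr (by omega)) h
    omega
  have hlam0 : lam ^ (n - 1) ≠ 0 := by
    have := digitCombination_add_pow (p := p) lam hn 0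
    rw [hzero, zero_add, zero_add] at this
    rw [← this, ← hzero]
    intro h
    have := hinj (Set.mem_Iio.mpr hpn) (Set.mem_Iio.mpr (by omega)) h
    exact (pow_pos hp.pos (n - 1)).ne' this
  have hlt := lt_card_support_of_eval_pow_add (ζ := (ζ : F)) (N := p ^ n - 1)
    (m := p ^ (n - 1)) (L := p ^ n - 1 - p ^ (n - 1)) (by omega)
    (by rw [orderOf_eq_card_sub_one hζ, hF]) hdeg hP0 hlam0 (by
      intro x hx
      rw [representingPoly_eval, representingPoly_eval,
        discreteLogMap_pow p n hF ζ hζ lam _ (by omega),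
        discreteLogMap_pow p n hF ζ hζ lam _ (by omega), digitCombination_add_pow lam hn])
  unfold mapWeight
  omega

theorem mapWeight_le_mapDegree_add_one (f : F → F) : mapWeight f ≤ mapDegree f + 1 :=
  card_supp_le_succ_natDegree _

theorem le_additiveIndex_discreteLogMap (hF : Fintype.card F = p ^ n) {ζ : Fˣ}
    (hζ : ∀ u : Fˣ, u ∈ Subgroup.zpowers ζ) {lam : F}
    (hlam : IntermediateField.adjoin (ZMod p) {lam} = ⊤) :
    p ^ n ≤ (n + 2) * additiveIndex p (discreteLogMap p n ζ lam) := by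
  classical
  have : CharP F p := charP_of_injective_algebraMap' (ZMod p) p
  have hp : p.Prime := Fact.out
  set f := discreteLogMap p n ζ lam with hf
  have hq : 1 < p ^ n := hF ▸ Fintype.one_lt_card
  -- `ζ = 1` happens only for `q = 2`, where the bound is trivial.
  rcases eq_or_ne (ζ : F) 1 with h1 | h1
  · have hord := orderOf_eq_card_sub_one hζ
    rw [h1, orderOf_one, hF] at hord
    have : 0 < additiveIndex p f := pow_pos hp.pos _
    have h2 : p ^ n ≤ n + 2 := by omega
    exact h2.trans (Nat.le_mul_of_pos_right _ this)
  have hval : ∀ x < p ^ n - 1, f ((ζ : F) ^ x) = digitCombination p n lam x :=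
    fun x hx => discreteLogMap_pow p n hF ζ hζ lam x hx
  -- Three sources: `y = 0`, the wrap-around at exponent `q - 2`, and the `n` possible carry
  -- lengths.
  set E : Finset F := insert 0 (insert (f 1 - f (ζ ^ (p ^ n - 2)))
    ((Finset.range n).image fun j => ∑ i ∈ Finset.range (j + 1), lam ^ i)) with hE
  have hEcard : E.card ≤ n + 2 := by
    refine (Finset.card_insert_le _ _).trans (Nat.succ_le_succ ?_)
    refine (Finset.card_insert_le _ _).trans (Nat.succ_le_succ ?_)
    exact Finset.card_image_le.trans (Finset.card_range n).le
  have hmem : ∀ y, f (ζ * y) - f y ∈ E := by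
    intro y
    rcases eq_or_ne y 0 with rfl | hy
    · simp [hE]
    obtain ⟨x, hx, rfl⟩ := exists_pow_eq_of_ne_zero hζ hy
    rw [hF] at hx
    rw [← pow_succ']
    rcases eq_or_ne (x + 1) (p ^ n - 1) with hx1 | hx1
    · have hone : (ζ : F) ^ (x + 1) = 1 := by
        rw [hx1, ← hF, ← orderOf_eq_card_sub_one hζ, pow_orderOf_eq_one]
      rw [hone, show x = p ^ n - 2 by omega]
      simp [hE]
    · rw [hval x hx, hval (x + 1) (by omega)]
      obtain ⟨j, hj, h⟩ := exists_digitCombination_succ (p := p) (n := n) lam (x := x) (by omega)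
      rw [h]
      refine Finset.mem_insert_of_mem (Finset.mem_insert_of_mem (Finset.mem_image.mpr ?_))
      exact ⟨j, Finset.mem_range.mpr hj, rfl⟩
  have := (hasCodimAtMost_mapCodim (p := p) f).card_le (discreteLogMap_injective hF hζ hlam) h1 hmem
  rw [hF] at this
  exact this.trans (Nat.mul_le_mul_right _ hEcard)

/-- A set of exponents at which the discrete logarithm map agrees with a fractional linear
transformation contains few pairs with a given difference. -/
theorem card_filter_add_mem_le {m : ℕ} (hF : Fintype.card F = p ^ (m + 1)) {ζ : Fˣ}
    (hζ : ∀ u : Fˣ, u ∈ Subgroup.zpowers ζ) {lam a b c d : F} (hdet : a * d - b * c ≠ 0)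
    {T : Finset ℕ} (hT : ∀ x ∈ T, x < p ^ (m + 1) - 1 ∧ c * (ζ : F) ^ x + d ≠ 0 ∧
      discreteLogMap p (m + 1) ζ lam ((ζ : F) ^ x) = (a * ζ ^ x + b) / (c * ζ ^ x + d))
    {k : ℕ} (hk0 : 0 < k) (hk : k < p ^ (m + 1) - 1) :
    (T.filter fun x => x + k ∈ T).card ≤ 2 * 2 ^ m := by
  classical
  have : CharP F p := charP_of_injective_algebraMap' (ZMod p) p
  choose carry hcarry using fun x => exists_carries (p := p) (n := m) lam x k
  have huniv : (Finset.univ : Finset (Fin m → Bool)).card = 2 ^ m := by simp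
  rw [← huniv]
  refine Finset.card_le_mul_card_image_of_maps_to (f := carry) (fun _ _ => Finset.mem_univ _) 2 ?_
  intro e _
  have hinj : Set.InjOn (fun x : ℕ => (ζ : F) ^ x)
      ((T.filter fun x => x + k ∈ T).filter fun x => carry x = e) := by
    intro x hx y hy hxy
    simp only [Finset.coe_filter, Finset.mem_filter, Set.mem_ofPred_eq] at hx hy
    have hord := orderOf_eq_card_sub_one hζ
    rw [hF] at hord
    exact pow_injOn_Iio_orderOf (by rw [hord]; exact (hT x hx.1.1).1)
      (by rw [hord]; exact (hT y hy.1.1).1) hxy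
  rw [← Finset.card_image_of_injOn hinj]
  refine card_le_two_of_fractionalLinear_sub_eq (z := (ζ : F) ^ k)
    (D := digitCombination p (m + 1) lam k +
      ∑ i : Fin m, if e i then lam ^ ((i : ℕ) + 1) else 0)
    hdet (pow_ne_zero _ ζ.ne_zero) (pow_pos_lt_ne_one hζ hk0 (by rwa [hF])) ?_
  intro y hy
  obtain ⟨x, hx, rfl⟩ := Finset.mem_image.mp hy
  simp only [Finset.mem_filter] at hx
  obtain ⟨⟨hx, hxk⟩, hxe⟩ := hx
  obtain ⟨hx1, hx2, hx3⟩ := hT x hx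
  obtain ⟨hxk1, hxk2, hxk3⟩ := hT _ hxk
  have hz : (ζ : F) ^ k * ζ ^ x = ζ ^ (x + k) := by rw [← pow_add, add_comm]
  rw [hz]
  refine ⟨hx2, hxk2, ?_⟩
  rw [← hx3, ← hxk3, discreteLogMap_pow p _ hF ζ hζ lam _ hx1,
    discreteLogMap_pow p _ hF ζ hζ lam _ hxk1, ← hxe]
  exact hcarry x

/-- A composition of affine maps and `r` inversions that equals the discrete logarithm map gives
a set `T` with at least `q - r - 1` elements and few pairs. -/
theorem exists_card_mul_card_sub_one_le (hn : 0 < n) (hF : Fintype.card F = p ^ n) {ζ : Fˣ}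
    (hζ : ∀ u : Fˣ, u ∈ Subgroup.zpowers ζ) {lam : F} {r : ℕ}
    (hr : IsInversionWord r (discreteLogMap p n ζ lam)) :
    ∃ N : ℕ, p ^ n ≤ N + 1 + r ∧ N * (N - 1) ≤ 2 * (2 ^ n * (p ^ n - 2)) := by
  classical
  obtain ⟨m, rfl⟩ : ∃ m, n = m + 1 := ⟨n - 1, by omega⟩
  obtain ⟨a, b, c, d, O, hdet, hO, h⟩ := hr.exists_fractionalLinear
  set T := (Finset.range (p ^ (m + 1) - 1)).filter fun x => (ζ : F) ^ x ∉ O with hTdef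
  have hT : ∀ x ∈ T, x < p ^ (m + 1) - 1 ∧ c * (ζ : F) ^ x + d ≠ 0 ∧
      discreteLogMap p (m + 1) ζ lam ((ζ : F) ^ x) = (a * ζ ^ x + b) / (c * ζ ^ x + d) := by
    intro x hx
    rw [hTdef, Finset.mem_filter, Finset.mem_range] at hx
    exact ⟨hx.1, h _ hx.2⟩
  refine ⟨T.card, ?_, ?_⟩
  -- The extra `1` in the bound is the point `0`, which has no exponent.
  · have hcover : (Finset.univ : Finset F) ⊆ insert 0 (T.image fun x => (ζ : F) ^ x) ∪ O := by
      intro y _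
      rcases eq_or_ne y 0 with rfl | hy
      · simp
      obtain ⟨x, hx, rfl⟩ := exists_pow_eq_of_ne_zero hζ hy
      rw [hF] at hx
      by_cases hxO : (ζ : F) ^ x ∈ O
      · exact Finset.mem_union_right _ hxO
      · refine Finset.mem_union_left _ (Finset.mem_insert_of_mem (Finset.mem_image_of_mem _ ?_))
        exact Finset.mem_filter.mpr ⟨Finset.mem_range.mpr hx, hxO⟩
    have h1 := Finset.card_le_card hcover
    have h2 := Finset.card_union_le (insert 0 (T.image fun x => (ζ : F) ^ x)) O
    have h3 := Finset.card_insert_le 0 (T.image fun x => (ζ : F) ^ x)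
    have h4 : (T.image fun x => (ζ : F) ^ x).card ≤ T.card := Finset.card_image_le
    rw [Finset.card_univ, hF] at h1
    omega
  · refine (Finset.card_mul_card_sub_one_le (fun x hx => (hT x hx).1) fun k hk0 hk =>
      card_filter_add_mem_le hF hζ hdet hT hk0 hk).trans_eq ?_
    rw [← pow_succ', Nat.sub_sub]

end DiscreteLogMap

/-! ### The theorem. -/

theorem mainTheorem5 (p n : ℕ) [Fact p.Prime] {F : Type*} [Field F] [Fintype F]
    [Algebra (ZMod p) F] (hF : Fintype.card F = p ^ n)
    (ζ : Fˣ) (hζ : ∀ u : Fˣ, u ∈ Subgroup.zpowers ζ)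
    (lam : F) (hlam : IntermediateField.adjoin (ZMod p) {lam} = ⊤) :
    Function.Bijective (discreteLogMap p n ζ lam) ∧
    (p : ℝ) ^ n - (p : ℝ) ^ n / p - 1 ≤ mapDegree (discreteLogMap p n ζ lam) ∧
    (p : ℝ) ^ n - (p : ℝ) ^ n / p ≤ mapWeight (discreteLogMap p n ζ lam) ∧
    (p : ℝ) ^ n / (n + 2) ≤ additiveIndex p (discreteLogMap p n ζ lam) ∧
    (2 < p → (p : ℝ) ^ n - 3 * (2 * (p : ℝ)) ^ ((n : ℝ) / 2) ≤
      carlitzRank (discreteLogMap p n ζ lam)) := by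
  have hp : p.Prime := Fact.out
  have hq : 1 < p ^ n := hF ▸ Fintype.one_lt_card
  have hn : 0 < n := Nat.pos_of_ne_zero fun h => by simp [h] at hq
  have hbij : Function.Bijective (discreteLogMap p n ζ lam) :=
    Finite.injective_iff_bijective.mp (discreteLogMap_injective hF hζ hlam)
  have hdiv : (p : ℝ) ^ n / p = (p : ℝ) ^ (n - 1) := by
    rw [div_eq_iff (by exact_mod_cast hp.ne_zero), ← pow_succ, Nat.sub_add_cancel hn]
  have hweight : (p : ℝ) ^ n ≤ mapWeight (discreteLogMap p n ζ lam) + (p : ℝ) ^ (n - 1) := by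
    exact_mod_cast le_mapWeight_discreteLogMap hn hF hζ hlam
  have hdegree : (mapWeight (discreteLogMap p n ζ lam) : ℝ) ≤
      mapDegree (discreteLogMap p n ζ lam) + 1 := by
    exact_mod_cast mapWeight_le_mapDegree_add_one (discreteLogMap p n ζ lam)
  refine ⟨hbij, by linarith, by linarith, ?_, fun hp2 => ?_⟩
  · rw [div_le_iff₀' (by positivity)]
    exact_mod_cast le_additiveIndex_discreteLogMap hF hζ hlam
  -- The infimum is attained only because some word exists; an empty set would give the default
  -- value `0`.
  · have hword : IsInversionWord (carlitzRank (discreteLogMap p n ζ lam))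
        (discreteLogMap p n ζ lam) :=
      Nat.sInf_mem (s := {r | IsInversionWord r (discreteLogMap p n ζ lam)})
        (exists_isInversionWord (Equiv.ofBijective _ hbij))
    obtain ⟨N, hN, hpairs⟩ := exists_card_mul_card_sub_one_le hn hF hζ hword
    set r := carlitzRank (discreteLogMap p n ζ lam)
    set t : ℝ := (2 * (p : ℝ)) ^ ((n : ℝ) / 2) with ht
    have ht2 : t ^ 2 = 2 ^ n * (p : ℝ) ^ n := by
      rw [ht, ← Real.rpow_natCast, ← Real.rpow_mul (by positivity)]
      rw [show (n : ℝ) / 2 * ((2 : ℕ) : ℝ) = n by push_cast; ring, Real.rpow_natCast, mul_pow]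
    have ht1 : 1 ≤ t := by
      refine Real.one_le_rpow ?_ (by positivity)
      have : (2 : ℝ) < p := by exact_mod_cast hp2
      linarith
    have hNr : (p : ℝ) ^ n ≤ N + 1 + r := by exact_mod_cast hN
    have hpr : (N : ℝ) * (N - 1) ≤ 2 * t ^ 2 := by
      rcases Nat.eq_zero_or_pos N with h0 | h0
      · rw [h0]; simp; positivity
      · have h1 : N * (N - 1) ≤ 2 * (2 ^ n * p ^ n) :=
          hpairs.trans (Nat.mul_le_mul_left _ (Nat.mul_le_mul_left _ (Nat.sub_le _ _)))
        rw [ht2, ← Nat.cast_pred h0]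
        exact_mod_cast h1
    -- Otherwise `t ≥ 1` gives `N > 2 t` and `N - 1 > t`, against `N (N - 1) ≤ 2 t ^ 2`.
    have hNt : (N : ℝ) + 1 ≤ 3 * t := by
      by_contra! hlt
      nlinarith
    linarith
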